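/- For $n\ge 1$ and $a\in\mathbb{C}$ let $J_n(a)$ be the $n\times n$ KMS matrix, whose $(p,q)$ entry is $a^{q-p}$ if $p<q$ and $0$ if $p\ge q$. For a square complex matrix $A$ let $\operatorname{Re}A=(A+A^*)/2$, let $\sigma(A)$ be its spectrum, let $W(A)=\{\langle Ax,x\rangle : \|x\|=1\}$ be its numerical range (for the standard inner product), and let $A[j]$ be the matrix obtained from $A$ by deleting its $j$th row and $j$th column. Boundaries are taken in $\mathbb{C}$. Let $n\ge 2$, let $a\in\mathbb{C}$ with $|a|\ne 0,1$, and let $b=\min\sigma(\operatorname{Re}J_n(a))$. Then for every $j$ with $1\le j\le n$, $$\partial W(J_n(a))\cap\partial W(J_n(a)[j])=\begin{cases}\{b\} & \text{if } n \text{ is odd},\ j=(n+1)/2 \text{ and } |a|>1,\\ \emptyset & \text{otherwise.}\end{cases}$$ Moreover, when $b$ is in this intersection, there is a unit vector $x=(x_1,\dots,x_n)^T\in\mathbb{C}^n$ with $x_j=0$ and $$x_{j+k}=-(\overline{a}/|a|)^{2k}\,x_{j-k}\qquad(1\le k\le j-1)$$ such that $(\operatorname{Re}J_n(a))x=bx$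 and $\langle J_n(a)x,x\rangle=b$. In particular, if $a$ is real, then $x$ is antisymmetric about its $j$th entry, that is, $x=[x_1\ \cdots\ x_{j-1}\ 0\ -x_{j-1}\ \cdots\ -x_1]^T$. -/

import Mathlib

open scoped ComplexStarModule

noncomputable section

/-- The `n × n` KMS matrix: strictly upper triangular, with entry `a ^ (q - p)` in row `p` and
column `q` whenever `p < q`. Indices run over `0, …, n - 1`. -/
def kmsMatrix (n : ℕ) (a : ℂ) : Matrix (Fin n) (Fin n) ℂ :=
  Matrix.of fun p q => if p < q then a ^ ((q : ℕ) - (p : ℕ)) else 0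

/-- The numerical range `{⟨A x, x⟩ : ‖x‖ = 1}` of a square complex matrix, for the standard inner
product (which in Mathlib is conjugate-linear in its first argument). -/
def numericalRange {ι : Type*} [Fintype ι] [DecidableEq ι] (A : Matrix ι ι ℂ) : Set ℂ :=
  {z | ∃ x : EuclideanSpace ℂ ι, ‖x‖ = 1 ∧ z = inner ℂ x (Matrix.toEuclideanLin A x)}

/-- The principal submatrix `A[j]`, obtained by deleting the `j`th row and the `j`th column. Its
rows and columns are indexed by the remaining indices. -/
def principalSubmatrix {ι : Type*} (A : Matrix ι ι ℂ) (j : ι) :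
    Matrix {i : ι // i ≠ j} {i : ι // i ≠ j} ℂ :=
  A.submatrix Subtype.val Subtype.val

end

/-!
A point `z ∈ ∂W(A) ∩ ∂W(A[j])` is `⟨A x, x⟩` for a unit vector `x` with `x_j = 0`. As `W(A)` is
convex (Toeplitz–Hausdorff), it has a supporting line at `z`, so for some unimodular `ω` the vector
`x` is an eigenvector of `ωA + (ωA)ᴴ` for its greatest eigenvalue `μ`; equivalently `x` lies in
the kernel of the positive semidefinite pencil `μ - (ωA + (ωA)ᴴ)`. A diagonal unitary
similarity reduces `A = J_n(a)` to `J = J_n(r)` with `r = |a| > 0`.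

Entries of `J` factor across a cut at any index, so the Hermitian form of the pencil at a truncation
of `x` is `ω (∑_{q ≥ m} r ^ (q - m) x_q)` times the conjugate of `∑_{q < m} r ^ (m - q) x_q`
(`star_truncBelow_dotProduct`). At a zero entry this must be nonnegative, which leaves only
`ω = -1` (`eq_neg_one_of_apply_eq_zero`); thus `x` is an eigenvector of `Re J` for its least
eigenvalue.

Then `x` is an eigenvector of the Toeplitz matrix `K = (r ^ |p - q|)` for its least eigenvalue
`κ = 1 - μ`. Since `K⁻¹` is tridiagonal, `K x` satisfies a three-term recurrence with boundary
condition `f(outside) = r f(end)`, hence is odd about the zero `j`. Testing the form on truncations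
perturbed at the cut (`cut_form_nonneg`) gives `κ < 0`; for `r < 1` the recurrence would then be
expanding and allow no zero, so `r > 1` (`one_lt_base_of_apply_eq_zero`). If `j` were not central,
the reflected boundary condition would hold at an interior cut and split off a kernel vector
vanishing at an end (`eq_two_mul_add_one_of_apply_eq_zero`), whereas `K` is invertible
(`ne_one_of_mem_ker`). So `x` is antisymmetric about the centre, which makes `⟨J x, x⟩` real, that
is, equal to the least eigenvalue.

Conversely, for `r > 1` and `n` odd, an eigenvector for the least eigenvalue cannot be symmetric, by
the same test inequality; its antisymmetric part vanishes at the centre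
(`exists_mem_ker_apply_eq_zero`).
-/

open scoped ComplexOrder InnerProductSpace Matrix

/-! ### Convexity and supporting lines of the numerical range -/

/-- The **Toeplitz–Hausdorff theorem** for a linear map on a complex inner product space. -/
theorem convex_setOf_inner_map_self {E : Type*} [NormedAddCommGroup E] [InnerProductSpace ℂ E]
    (T : E →ₗ[ℂ] E) : Convex ℝ {z : ℂ | ∃ x : E, ‖x‖ = 1 ∧ z = ⟪x, T x⟫_ℂ} := by
  rintro α ⟨x, hx, hα⟩ β ⟨y, hy, hβ⟩ s t hs ht hst
  by_cases hne : α = β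
  · refine ⟨x, hx, ?_⟩
    rw [← hα, ← hne, ← add_smul, hst, one_smul]
  have hd : β - α ≠ 0 := sub_ne_zero.2 (Ne.symm hne)
  set p : ℂ := (⟪x, T y⟫_ℂ - α * ⟪x, y⟫_ℂ) / (β - α) with hp
  set q : ℂ := (⟪y, T x⟫_ℂ - α * ⟪y, x⟫_ℂ) / (β - α) with hq
  -- rotate and scale `x` by `c ≠ 0` so that the cross terms become real relative to `β - α`
  obtain ⟨c, hc0, hc⟩ : ∃ c : ℂ, c ≠ 0 ∧ ((starRingEnd ℂ) c * p + c * q).im = 0 := by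
    by_cases h0 : (⟨p.re - q.re, p.im + q.im⟩ : ℂ) = 0
    · refine ⟨1, one_ne_zero, ?_⟩
      have := congrArg Complex.im h0
      simpa using this
    · refine ⟨_, h0, ?_⟩
      simp
      ring
  set k : ℝ := ((starRingEnd ℂ) c * p + c * q).re with hk
  have hkc : (starRingEnd ℂ) c * p + c * q = (k : ℂ) := by
    apply Complex.ext <;> simp [hk, hc]
  have hxx : ⟪x, x⟫_ℂ = 1 := by rw [inner_self_eq_norm_sq_to_K, hx]; simp
  have hyy : ⟪y, y⟫_ℂ = 1 := by rw [inner_self_eq_norm_sq_to_K, hy]; simp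
  let v : ℝ → E := fun τ => (((1 - τ : ℝ) : ℂ) * c) • x + ((τ : ℝ) : ℂ) • y
  have hv0 : ∀ τ, v τ ≠ 0 := by
    intro τ h
    -- a vanishing combination makes `x` and `y` parallel unit vectors, hence `α = β`
    by_cases hτ : τ = 0
    · simp only [v, hτ] at h
      simp [hc0] at h
      rw [h] at hx; simp at hx
    · have hτ' : (τ : ℂ) ≠ 0 := by exact_mod_cast hτ
      have hy' : y = (-((1 - τ : ℝ) : ℂ) * c / τ) • x := by
        have h1 : (τ : ℂ) • y = -((((1 - τ : ℝ) : ℂ) * c) • x) :=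
          eq_neg_of_add_eq_zero_right h
        rw [← smul_right_injective E hτ' |>.eq_iff]
        simp only [h1, smul_smul]
        rw [← neg_smul]; congr 1; field_simp
      apply hne
      rw [hβ, hα]
      rw [hy'] at hyy ⊢
      generalize (-((1 - τ : ℝ) : ℂ) * c / τ) = e at hyy ⊢
      rw [inner_smul_left, inner_smul_right, hxx] at hyy
      rw [map_smul, inner_smul_left, inner_smul_right, ← mul_assoc]
      rw [mul_one] at hyy
      rw [hyy, one_mul]
  have hform : ∀ τ, ⟪v τ, T (v τ)⟫_ℂ =
      α * ⟪v τ, v τ⟫_ℂ + ((τ ^ 2 + τ * (1 - τ) * k : ℝ) : ℂ) * (β - α) := by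
    intro τ
    have e1 : ⟪x, T y⟫_ℂ = p * (β - α) + α * ⟪x, y⟫_ℂ := by rw [hp]; field_simp; ring
    have e2 : ⟪y, T x⟫_ℂ = q * (β - α) + α * ⟪y, x⟫_ℂ := by rw [hq]; field_simp; ring
    simp only [v, map_add, map_smul, inner_add_left, inner_add_right, inner_smul_left,
      inner_smul_right, map_mul, Complex.conj_ofReal, hxx, hyy, ← hα, ← hβ, e1, e2]
    push_cast
    rw [← hkc]
    ring
  let h : ℝ → ℝ := fun τ => (τ ^ 2 + τ * (1 - τ) * k) / ‖v τ‖ ^ 2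
  have hvc : Continuous v := by fun_prop
  have hcont : Continuous h := by
    refine Continuous.div (by fun_prop) (by fun_prop) fun τ => ?_
    exact pow_ne_zero _ (norm_ne_zero_iff.2 (hv0 τ))
  have h0 : h 0 = 0 := by simp [h]
  have h1 : h 1 = 1 := by simp [h, v, hy]
  obtain ⟨τ, -, hτ⟩ : t ∈ h '' Set.Icc 0 1 := by
    apply intermediate_value_Icc zero_le_one hcont.continuousOn
    rw [h0, h1]; exact ⟨ht, by linarith⟩
  have hn : (‖v τ‖ : ℂ) ≠ 0 := by exact_mod_cast norm_ne_zero_iff.2 (hv0 τ)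
  refine ⟨((‖v τ‖ : ℂ)⁻¹) • v τ, ?_, ?_⟩
  · rw [norm_smul, norm_inv, Complex.norm_real, norm_norm]
    exact inv_mul_cancel₀ (norm_ne_zero_iff.2 (hv0 τ))
  · have hτ' : ((τ ^ 2 + τ * (1 - τ) * k : ℝ) : ℂ) = t * (‖v τ‖ : ℂ) ^ 2 := by
      rw [← hτ]; simp only [h]; push_cast; field_simp
    rw [map_smul, inner_smul_left, inner_smul_right, hform, hτ', inner_self_eq_norm_sq_to_K]
    simp only [map_inv₀, Complex.conj_ofReal, Complex.real_smul, Complex.coe_algebraMap]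
    have hst' : (s : ℂ) = 1 - t := by
      have : s = 1 - t := by linarith
      rw [this]; push_cast; rfl
    rw [hst']
    field_simp
    ring

theorem convex_numericalRange {ι : Type*} [Fintype ι] [DecidableEq ι] (A : Matrix ι ι ℂ) :
    Convex ℝ (numericalRange A) :=
  convex_setOf_inner_map_self _

theorem isCompact_numericalRange {ι : Type*} [Fintype ι] [DecidableEq ι] (A : Matrix ι ι ℂ) :
    IsCompact (numericalRange A) := by
  have h : numericalRange A = (fun x : EuclideanSpace ℂ ι => ⟪x, Matrix.toEuclideanLin A x⟫_ℂ) ''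
      Metric.sphere 0 1 := by
    ext z
    simp only [numericalRange, Set.mem_ofPred_eq, Set.mem_image, mem_sphere_zero_iff_norm]
    exact exists_congr fun x => and_congr_right fun _ => eq_comm
  rw [h]
  refine (isCompact_sphere _ _).image ?_
  exact continuous_id.inner (LinearMap.continuous_of_finiteDimensional _)

/-- Every real linear functional on `ℂ` is `w ↦ Re (ω w)` for some `ω`. -/
theorem exists_eq_re_mul (f : ℂ →ₗ[ℝ] ℝ) : ∃ ω : ℂ, ∀ w, f w = (ω * w).re := by
  refine ⟨⟨f 1, -f Complex.I⟩, fun w => ?_⟩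
  have : w = w.re • (1 : ℂ) + w.im • Complex.I := by
    simp [Complex.re_add_im]
  conv_lhs => rw [this]
  simp only [map_add, map_smul, smul_eq_mul, Complex.mul_re]
  ring

/-- A convex set in `ℂ` has a supporting line at each point of its frontier. -/
theorem exists_norm_eq_one_re_mul_le {S : Set ℂ} (hS : Convex ℝ S) {z : ℂ} (hzS : z ∈ S)
    (hz : z ∈ frontier S) : ∃ ω : ℂ, ‖ω‖ = 1 ∧ ∀ w ∈ S, (ω * w).re ≤ (ω * z).re := by
  obtain ⟨f, hf0, hf⟩ : ∃ f : ℂ →ₗ[ℝ] ℝ, f ≠ 0 ∧ ∀ w ∈ S, f w ≤ f z := by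
    by_cases hint : (interior S).Nonempty
    · obtain ⟨f, hf0, hf⟩ := geometric_hahn_banach_of_nonempty_interior_point hS hz.2 hint
      refine ⟨f, fun h => hf0 ?_, hf⟩
      ext1 w
      exact LinearMap.congr_fun h w
    · -- a convex set with empty interior lies on a line, on which some functional is constant
      have hspan : affineSpan ℝ S ≠ ⊤ := fun h =>
        hint (hS.interior_nonempty_iff_affineSpan_eq_top.2 h)
      have hdir : (affineSpan ℝ S).direction < ⊤ := by
        rw [lt_top_iff_ne_top]
        intro h
        exact hspan ((AffineSubspace.direction_eq_top_iff_of_nonempty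
          ⟨z, subset_affineSpan ℝ S hzS⟩).1 h)
      obtain ⟨f, hf0, hf⟩ := Submodule.exists_le_ker_of_lt_top _ hdir
      refine ⟨f, hf0, fun w hw => ?_⟩
      have : w -ᵥ z ∈ (affineSpan ℝ S).direction :=
        AffineSubspace.vsub_mem_direction (subset_affineSpan ℝ S hw) (subset_affineSpan ℝ S hzS)
      have h0 := hf this
      rw [LinearMap.mem_ker, vsub_eq_sub, map_sub] at h0
      linarith
  obtain ⟨ω, hω⟩ := exists_eq_re_mul f
  have hω0 : ω ≠ 0 := by
    rintro rfl
    apply hf0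
    ext1 w
    simp [hω]
  have hpos : 0 < ‖ω‖ := norm_pos_iff.2 hω0
  refine ⟨((‖ω‖⁻¹ : ℝ) : ℂ) * ω, ?_, fun w hw => ?_⟩
  · rw [norm_mul, Complex.norm_real, norm_inv, norm_norm, inv_mul_cancel₀ hpos.ne']
  · rw [mul_assoc, mul_assoc, Complex.re_ofReal_mul, Complex.re_ofReal_mul, ← hω, ← hω]
    exact mul_le_mul_of_nonneg_left (hf w hw) (inv_nonneg.2 hpos.le)

/-! ### The numerical range of a principal submatrix -/

theorem inner_toEuclideanLin_eq_dotProduct {ι : Type*} [Fintype ι] [DecidableEq ι]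
    (A : Matrix ι ι ℂ) (x : EuclideanSpace ℂ ι) :
    ⟪x, Matrix.toEuclideanLin A x⟫_ℂ = star x.ofLp ⬝ᵥ (A *ᵥ x.ofLp) := by
  rw [EuclideanSpace.inner_eq_star_dotProduct, dotProduct_comm, Matrix.toLpLin_apply]

theorem norm_eq_one_iff_dotProduct {ι : Type*} [Fintype ι] (x : EuclideanSpace ℂ ι) :
    ‖x‖ = 1 ↔ star x.ofLp ⬝ᵥ x.ofLp = 1 := by
  rw [dotProduct_comm, ← EuclideanSpace.inner_eq_star_dotProduct, inner_self_eq_norm_sq_to_K]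
  constructor
  · intro h; simp [h]
  · intro h
    have h2 : ‖x‖ ^ 2 = 1 := by
      have h1 : ((‖x‖ ^ 2 : ℝ) : ℂ) = 1 := by push_cast; exact h
      exact_mod_cast h1
    nlinarith [norm_nonneg x]

theorem mem_numericalRange_iff {ι : Type*} [Fintype ι] [DecidableEq ι] {A : Matrix ι ι ℂ} {z : ℂ} :
    z ∈ numericalRange A ↔ ∃ x : ι → ℂ, star x ⬝ᵥ x = 1 ∧ z = star x ⬝ᵥ (A *ᵥ x) := by
  constructor
  · rintro ⟨x, hx, rfl⟩
    exact ⟨x.ofLp, (norm_eq_one_iff_dotProduct x).1 hx, inner_toEuclideanLin_eq_dotProduct A x⟩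
  · rintro ⟨x, hx, rfl⟩
    exact ⟨WithLp.toLp 2 x, (norm_eq_one_iff_dotProduct _).2 hx,
      (inner_toEuclideanLin_eq_dotProduct A (WithLp.toLp 2 x)).symm⟩

theorem sum_subtype_ne {ι : Type*} [Fintype ι] [DecidableEq ι] (j : ι) (f : ι → ℂ) (hf : f j = 0) :
    ∑ i : {i // i ≠ j}, f i = ∑ i, f i := by
  rw [← Finset.sum_subtype (Finset.univ.erase j) (by simp) f]
  exact Finset.sum_erase _ hf

/-- Extending by zero identifies `W(A[j])` with the values of the form of `A` at the unit vectors
whose `j`th entry vanishes. -/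
theorem mem_numericalRange_principalSubmatrix_iff {ι : Type*} [Fintype ι] [DecidableEq ι]
    {A : Matrix ι ι ℂ} {j : ι} {z : ℂ} :
    z ∈ numericalRange (principalSubmatrix A j) ↔
      ∃ x : ι → ℂ, x j = 0 ∧ star x ⬝ᵥ x = 1 ∧ z = star x ⬝ᵥ (A *ᵥ x) := by
  have key : ∀ x : ι → ℂ, x j = 0 →
      star (fun i : {i // i ≠ j} => x i) ⬝ᵥ (fun i : {i // i ≠ j} => x i) = star x ⬝ᵥ x ∧
      star (fun i : {i // i ≠ j} => x i) ⬝ᵥ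
        (principalSubmatrix A j *ᵥ (fun i : {i // i ≠ j} => x i)) = star x ⬝ᵥ (A *ᵥ x) := by
    intro x hx
    have h2 : ∀ i : {i // i ≠ j},
        (principalSubmatrix A j *ᵥ (fun i : {i // i ≠ j} => x i)) i = (A *ᵥ x) i := fun i =>
      sum_subtype_ne j (fun k => A i k * x k) (by simp [hx])
    constructor
    · exact sum_subtype_ne j (fun i => star (x i) * x i) (by simp [hx])
    · simp only [dotProduct, h2, Pi.star_apply]
      exact sum_subtype_ne j (fun i => star (x i) * (A *ᵥ x) i) (by simp [hx])
  rw [mem_numericalRange_iff]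
  constructor
  · rintro ⟨x, hx, rfl⟩
    let y : ι → ℂ := fun i => if h : i ≠ j then x ⟨i, h⟩ else 0
    have hy : y j = 0 := by simp [y]
    have hyx : (fun i : {i // i ≠ j} => y i) = x := by
      ext i; simp [y, i.2]
    obtain ⟨k1, k2⟩ := key y hy
    rw [hyx] at k1 k2
    exact ⟨y, hy, k1 ▸ hx, k2⟩
  · rintro ⟨x, hxj, hx, rfl⟩
    obtain ⟨k1, k2⟩ := key x hxj
    exact ⟨_, k1.trans hx, k2.symm⟩

/-- Since `W(A[j]) ⊆ W(A)`, a point of `∂W(A)` lying in `W(A[j])` is automatically on the boundary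
of the latter. -/
theorem frontier_inter_frontier_principalSubmatrix {ι : Type*} [Fintype ι] [DecidableEq ι]
    (A : Matrix ι ι ℂ) (j : ι) :
    frontier (numericalRange A) ∩ frontier (numericalRange (principalSubmatrix A j)) =
      frontier (numericalRange A) ∩ numericalRange (principalSubmatrix A j) := by
  have hsub : numericalRange (principalSubmatrix A j) ⊆ numericalRange A := by
    intro z hz
    obtain ⟨x, -, hx, hz⟩ := mem_numericalRange_principalSubmatrix_iff.1 hz
    exact mem_numericalRange_iff.2 ⟨x, hx, hz⟩
  ext z
  constructor
  · rintro ⟨h1, h2⟩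
    exact ⟨h1, (isCompact_numericalRange _).isClosed.frontier_subset h2⟩
  · rintro ⟨h1, h2⟩
    exact ⟨h1, subset_closure h2, fun h => h1.2 (interior_mono hsub h)⟩

/-! ### The Hermitian pencil of a rotated KMS matrix -/

/-- The Hermitian matrix `μ - (ω J + (ω J)ᴴ)`, where `J = J_n(r)` with `r` real, so that
`Jᴴ = Jᵀ`. Positive semidefiniteness says that `μ / 2` bounds the real part of `ω • W(J)`. -/
noncomputable def kmsPencil (n : ℕ) (r : ℝ) (ω : ℂ) (μ : ℝ) : Matrix (Fin n) (Fin n) ℂ :=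
  (μ : ℂ) • 1 - (ω • kmsMatrix n (r : ℂ) + starRingEnd ℂ ω • (kmsMatrix n (r : ℂ))ᵀ)

/-- `∑_{q > p} r ^ (q - p) x_q`. -/
noncomputable def upperSum {n : ℕ} (r : ℝ) (x : Fin n → ℂ) (p : Fin n) : ℂ :=
  (kmsMatrix n (r : ℂ) *ᵥ x) p

/-- `∑_{q < p} r ^ (p - q) x_q`. -/
noncomputable def lowerSum {n : ℕ} (r : ℝ) (x : Fin n → ℂ) (p : Fin n) : ℂ :=
  ((kmsMatrix n (r : ℂ))ᵀ *ᵥ x) p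

/-- The truncation of `x` to the indices below `m`. -/
def truncBelow {n : ℕ} (m : Fin n) (x : Fin n → ℂ) : Fin n → ℂ :=
  fun i => if i < m then x i else 0

section

variable {n : ℕ} {r μ : ℝ} {ω : ℂ} {x : Fin n → ℂ}

theorem upperSum_apply (r : ℝ) (x : Fin n → ℂ) (p : Fin n) :
    upperSum r x p = ∑ q : Fin n, if p < q then (r : ℂ) ^ ((q : ℕ) - p) * x q else 0 := by
  simp [upperSum, kmsMatrix, Matrix.mulVec, dotProduct, ite_mul]

theorem lowerSum_apply (r : ℝ) (x : Fin n → ℂ) (p : Fin n) :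
    lowerSum r x p = ∑ q : Fin n, if q < p then (r : ℂ) ^ ((p : ℕ) - q) * x q else 0 := by
  simp [lowerSum, kmsMatrix, Matrix.mulVec, dotProduct, ite_mul]

theorem kmsPencil_mulVec (r μ : ℝ) (ω : ℂ) (x : Fin n → ℂ) (p : Fin n) :
    (kmsPencil n r ω μ *ᵥ x) p =
      μ * x p - (ω * upperSum r x p + starRingEnd ℂ ω * lowerSum r x p) := by
  simp [kmsPencil, upperSum, lowerSum, Matrix.sub_mulVec, Matrix.add_mulVec, Matrix.smul_mulVec]

theorem upperSum_rev (r : ℝ) (x : Fin n → ℂ) (p : Fin n) :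
    upperSum r (x ∘ Fin.rev) p = lowerSum r x p.rev := by
  rw [upperSum_apply, lowerSum_apply]
  refine Fintype.sum_equiv Fin.revPerm _ _ fun q => ?_
  simp only [Fin.revPerm_apply, Fin.rev_lt_rev, Function.comp, Fin.val_rev]
  split_ifs with h
  · congr 2; have := Fin.lt_def.1 h; omega
  · rfl

theorem lowerSum_rev (r : ℝ) (x : Fin n → ℂ) (p : Fin n) :
    lowerSum r (x ∘ Fin.rev) p = upperSum r x p.rev := by
  have := upperSum_rev r (x ∘ Fin.rev) p.rev
  rw [Fin.rev_rev] at this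
  rw [← this]
  congr 1; ext i; simp

theorem kmsPencil_mulVec_rev (r μ : ℝ) (ω : ℂ) (x : Fin n → ℂ) (p : Fin n) :
    (kmsPencil n r ω μ *ᵥ (x ∘ Fin.rev)) p =
      (kmsPencil n r (starRingEnd ℂ ω) μ *ᵥ x) p.rev := by
  rw [kmsPencil_mulVec, kmsPencil_mulVec, upperSum_rev, lowerSum_rev, Complex.conj_conj]
  simp [add_comm]

theorem kmsPencil_mulVec_rev_eq_zero (h : kmsPencil n r ω μ *ᵥ x = 0) :
    kmsPencil n r (starRingEnd ℂ ω) μ *ᵥ (x ∘ Fin.rev) = 0 := by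
  ext p
  rw [kmsPencil_mulVec_rev, Complex.conj_conj, h]; rfl

theorem lowerSum_succ (r : ℝ) (x : Fin n → ℂ) {p q : Fin n} (h : (p : ℕ) + 1 = q) :
    lowerSum r x q = r * (lowerSum r x p + x p) := by
  rw [lowerSum_apply, lowerSum_apply]
  have hx : x p = ∑ i : Fin n, if i = p then x i else 0 := by simp
  rw [hx, ← Finset.sum_add_distrib, Finset.mul_sum]
  refine Finset.sum_congr rfl fun i _ => ?_
  rcases lt_trichotomy i p with hi | rfl | hi
  · have h1 : i < q := by rw [Fin.lt_def] at *; omega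
    have h2 : (q : ℕ) - i = (p - i : ℕ) + 1 := by rw [Fin.lt_def] at *; omega
    rw [if_pos h1, if_pos hi, if_neg hi.ne, h2]; ring
  · have h1 : i < q := by rw [Fin.lt_def]; omega
    have h2 : (q : ℕ) - i = 1 := by omega
    rw [if_pos h1, if_neg (lt_irrefl _), if_pos rfl, h2]; ring
  · have h1 : ¬ i < q := by rw [Fin.lt_def] at *; omega
    rw [if_neg h1, if_neg hi.not_gt, if_neg hi.ne']; ring

theorem upperSum_pred (r : ℝ) (x : Fin n → ℂ) {p q : Fin n} (h : (p : ℕ) + 1 = q) :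
    upperSum r x p = r * (upperSum r x q + x q) := by
  have h' : (q.rev : ℕ) + 1 = p.rev := by simp only [Fin.val_rev]; omega
  have := lowerSum_succ r (x ∘ Fin.rev) h'
  simpa [lowerSum_rev] using this

theorem kmsPencil_isHermitian (n : ℕ) (r : ℝ) (ω : ℂ) (μ : ℝ) :
    (kmsPencil n r ω μ).IsHermitian := by
  ext p q
  simp only [kmsPencil, kmsMatrix, Matrix.conjTranspose_apply, Matrix.sub_apply, Matrix.smul_apply,
    Matrix.add_apply, Matrix.transpose_apply, Matrix.of_apply, Matrix.one_apply, smul_eq_mul]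
  by_cases h : p = q
  · simp [h]
  · rcases lt_or_gt_of_ne h with h' | h' <;>
      simp [h, Ne.symm h, h', h'.not_gt]

/-! ### Vectors in the kernel of the pencil -/

/-- A kernel vector whose last entry is zero determines the pencil: the two rows at the end of its
support read `x_m = -∑_{q < m} r ^ (m - q) x_q` and `μ x_m = -ω̄ x_m`. -/
theorem eq_neg_conj_of_last_eq_zero (hr : r ≠ 0) (hω : ω ≠ 0)
    (hx : kmsPencil n r ω μ *ᵥ x = 0) (hx0 : x ≠ 0)
    (hlast : ∀ i : Fin n, (i : ℕ) + 1 = n → x i = 0) : (μ : ℂ) = -starRingEnd ℂ ω := by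
  obtain ⟨i, hi⟩ := Function.ne_iff.1 hx0
  obtain ⟨m, hm, hmax⟩ := Finset.exists_max_image (Finset.univ.filter fun i => x i ≠ 0)
    (fun i => i) ⟨i, by simpa using hi⟩
  simp only [Finset.mem_filter, Finset.mem_univ, true_and] at hm hmax
  have hzero : ∀ i, m < i → x i = 0 := fun i h => by
    by_contra h'
    exact absurd (hmax i h') h.not_ge
  have hupper : ∀ i, m ≤ i → upperSum r x i = 0 := fun i h => by
    rw [upperSum_apply]
    refine Finset.sum_eq_zero fun q _ => ?_
    split_ifs with hq
    · rw [hzero q (h.trans_lt hq), mul_zero]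
    · rfl
  have hmn : (m : ℕ) + 1 < n := by
    have h1 := m.2
    by_contra h
    exact hm (hlast m (by omega))
  have hr' : (r : ℂ) ≠ 0 := by exact_mod_cast hr
  have hω' : starRingEnd ℂ ω ≠ 0 := by simpa using hω
  have e1 := congrFun hx ⟨m + 1, hmn⟩
  have e2 := congrFun hx m
  rw [kmsPencil_mulVec, hupper _ (by rw [Fin.le_def]; simp),
    hzero _ (by rw [Fin.lt_def]; simp), lowerSum_succ r x (p := m) rfl] at e1
  rw [kmsPencil_mulVec, hupper _ le_rfl] at e2
  have e3 : lowerSum r x m = -x m := by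
    have : starRingEnd ℂ ω * (r * (lowerSum r x m + x m)) = 0 := by
      simpa using e1
    have := (mul_eq_zero.1 ((mul_eq_zero.1 this).resolve_left hω')).resolve_left hr'
    exact eq_neg_of_add_eq_zero_left this
  rw [e3] at e2
  have : ((μ : ℂ) + starRingEnd ℂ ω) * x m = 0 := by
    simp only [Pi.zero_apply] at e2
    linear_combination e2
  exact eq_neg_of_add_eq_zero_left ((mul_eq_zero.1 this).resolve_right hm)

theorem eq_neg_of_first_eq_zero (hr : r ≠ 0) (hω : ω ≠ 0)
    (hx : kmsPencil n r ω μ *ᵥ x = 0) (hx0 : x ≠ 0)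
    (hfirst : ∀ i : Fin n, (i : ℕ) = 0 → x i = 0) : (μ : ℂ) = -ω := by
  have hω' : starRingEnd ℂ ω ≠ 0 := by simpa using hω
  have := eq_neg_conj_of_last_eq_zero hr hω' (kmsPencil_mulVec_rev_eq_zero hx)
    (fun h => hx0 ?_) (fun i hi => hfirst _ (by rw [Fin.val_rev]; omega))
  · simpa using this
  · ext i
    simpa using congrFun h i.rev

theorem upperSum_sub_truncBelow (r : ℝ) (x : Fin n → ℂ) {m p : Fin n} (h : p < m) :
    upperSum r (x - truncBelow m x) p = (r : ℂ) ^ ((m : ℕ) - p) * (upperSum r x m + x m) := by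
  rw [upperSum_apply, upperSum_apply]
  have hx : x m = ∑ i : Fin n, if i = m then x i else 0 := by simp
  rw [hx, ← Finset.sum_add_distrib, Finset.mul_sum]
  refine Finset.sum_congr rfl fun i _ => ?_
  simp only [Pi.sub_apply, truncBelow]
  rcases lt_trichotomy i m with hi | rfl | hi
  · simp [hi, hi.ne, hi.not_gt]
  · simp [h]
  · have h1 : p < i := h.trans hi
    have h2 : (i : ℕ) - p = (m - p : ℕ) + (i - m) := by rw [Fin.lt_def] at *; omega
    rw [if_neg hi.not_gt, if_pos h1, if_pos hi, if_neg hi.ne', h2]; ring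

theorem lowerSum_sub_truncBelow (r : ℝ) (x : Fin n → ℂ) {m p : Fin n} (h : p ≤ m) :
    lowerSum r (x - truncBelow m x) p = 0 := by
  rw [lowerSum_apply]
  refine Finset.sum_eq_zero fun i _ => ?_
  split_ifs with hi
  · simp [truncBelow, hi.trans_le h]
  · rfl

/-- The value of the Hermitian form at a truncated kernel vector factors into the interaction of
the two sides of the cut. -/
theorem star_truncBelow_dotProduct (hx : kmsPencil n r ω μ *ᵥ x = 0) (m : Fin n) :
    star (truncBelow m x) ⬝ᵥ (kmsPencil n r ω μ *ᵥ truncBelow m x) =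
      ω * (upperSum r x m + x m) * starRingEnd ℂ (lowerSum r x m) := by
  have h1 : kmsPencil n r ω μ *ᵥ truncBelow m x =
      -(kmsPencil n r ω μ *ᵥ (x - truncBelow m x)) := by
    rw [Matrix.mulVec_sub, hx]; simp
  rw [h1, lowerSum_apply, map_sum, Finset.mul_sum]
  refine Finset.sum_congr rfl fun i _ => ?_
  simp only [Pi.star_apply, Pi.neg_apply]
  rw [kmsPencil_mulVec]
  by_cases hi : i < m
  · rw [upperSum_sub_truncBelow r x hi, lowerSum_sub_truncBelow r x hi.le]
    simp [truncBelow, hi]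
    ring
  · simp [truncBelow, hi]

theorem kmsPencil_mulVec_truncBelow (r μ : ℝ) (ω : ℂ) (x : Fin n → ℂ) (m : Fin n) :
    (kmsPencil n r ω μ *ᵥ truncBelow m x) m = -(starRingEnd ℂ ω * lowerSum r x m) := by
  have h1 : upperSum r (truncBelow m x) m = 0 := by
    rw [upperSum_apply]
    refine Finset.sum_eq_zero fun i _ => ?_
    split_ifs with hi
    · simp [truncBelow, hi.not_gt]
    · rfl
  have h2 := lowerSum_sub_truncBelow r x (le_refl m)
  have h3 : lowerSum r (truncBelow m x) m = lowerSum r x m := by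
    rw [lowerSum, Matrix.mulVec_sub] at h2
    exact (sub_eq_zero.1 h2).symm
  rw [kmsPencil_mulVec, h1, h3]
  simp [truncBelow]

/-- If a truncation of a kernel vector is isotropic, both pieces lie in the kernel, and a nonzero
one of them vanishes at an end. -/
theorem eq_neg_or_eq_neg_conj_of_isotropic (hr : r ≠ 0) (hω : ω ≠ 0)
    (hP : (kmsPencil n r ω μ).PosSemidef) (hx : kmsPencil n r ω μ *ᵥ x = 0) (hx0 : x ≠ 0)
    {m : Fin n} (hm : (m : ℕ) ≠ 0 ∨ x m = 0)
    (h : (upperSum r x m + x m) * starRingEnd ℂ (lowerSum r x m) = 0) :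
    (μ : ℂ) = -ω ∨ (μ : ℂ) = -starRingEnd ℂ ω := by
  have hT : kmsPencil n r ω μ *ᵥ truncBelow m x = 0 := by
    rw [← hP.dotProduct_mulVec_zero_iff, star_truncBelow_dotProduct hx, mul_assoc, h, mul_zero]
  by_cases hT0 : truncBelow m x = 0
  · left
    refine eq_neg_of_first_eq_zero hr hω hx hx0 fun i hi => ?_
    by_cases him : i = m
    · subst him
      exact hm.resolve_left (not_not.2 hi)
    · have : i < m := lt_of_le_of_ne (by rw [Fin.le_def]; omega) him
      simpa [truncBelow, this] using congrFun hT0 i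
  · right
    refine eq_neg_conj_of_last_eq_zero hr hω hT hT0 fun i hi => ?_
    have : ¬ i < m := by rw [Fin.lt_def]; omega
    simp [truncBelow, this]

/-- Supporting directions other than that of the least eigenvalue of `Re J` admit no maximizing
vector with a zero entry. -/
theorem eq_neg_one_of_apply_eq_zero (hr : r ≠ 0) (hω : ‖ω‖ = 1)
    (hP : (kmsPencil n r ω μ).PosSemidef) (hx : kmsPencil n r ω μ *ᵥ x = 0) (hx0 : x ≠ 0)
    {j : Fin n} (hj : x j = 0) : ω = -1 := by
  have hω0 : ω ≠ 0 := by rintro rfl; simp at hω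
  have hμ : 0 ≤ μ := by
    have := hP.diag_nonneg (i := j)
    simpa [kmsPencil, kmsMatrix] using this
  have hrow : ω * upperSum r x j = -(starRingEnd ℂ ω * lowerSum r x j) := by
    have := congrFun hx j
    rw [kmsPencil_mulVec, hj] at this
    simp only [Pi.zero_apply] at this
    linear_combination -this
  -- a unit complex number that is real and nonnegative equals `1`
  have hunit : ∀ c : ℂ, ‖c‖ = 1 → 0 ≤ c → c = 1 := fun c h1 h2 => by
    rw [← Complex.norm_of_nonneg' h2, h1]; simp
  by_cases hL : lowerSum r x j = 0
  · have hcases := eq_neg_or_eq_neg_conj_of_isotropic hr hω0 hP hx hx0 (m := j) (Or.inr hj)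
      (by rw [hL]; simp)
    have hμ' : (0 : ℂ) ≤ μ := by exact_mod_cast hμ
    rcases hcases with h | h
    · have := hunit (-ω) (by simpa using hω) (h ▸ hμ')
      rw [← this]; ring
    · have := hunit (-starRingEnd ℂ ω) (by simpa using hω) (h ▸ hμ')
      have := congrArg (starRingEnd ℂ) this
      simp only [map_neg, Complex.conj_conj, map_one] at this
      rw [← this]; ring
  · have h0 := hP.dotProduct_mulVec_nonneg (truncBelow j x)
    rw [star_truncBelow_dotProduct hx, hj, add_zero, hrow] at h0
    have h1 : -(starRingEnd ℂ ω * lowerSum r x j) * starRingEnd ℂ (lowerSum r x j) =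
        -starRingEnd ℂ ω * ((‖lowerSum r x j‖ ^ 2 : ℝ) : ℂ) := by
      rw [neg_mul, mul_assoc, Complex.mul_conj, Complex.normSq_eq_norm_sq, neg_mul]
    rw [h1] at h0
    have hpos : 0 < ‖lowerSum r x j‖ ^ 2 := pow_pos (norm_pos_iff.2 hL) 2
    have hc : 0 ≤ -starRingEnd ℂ ω := by
      have hi : (0 : ℂ) ≤ (((‖lowerSum r x j‖ ^ 2)⁻¹ : ℝ) : ℂ) := by
        exact_mod_cast (inv_pos.2 hpos).le
      have := mul_nonneg h0 hi
      rwa [mul_assoc, ← Complex.ofReal_mul, mul_inv_cancel₀ hpos.ne', Complex.ofReal_one,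
        mul_one] at this
    have := hunit (-starRingEnd ℂ ω) (by simpa using hω) hc
    have := congrArg (starRingEnd ℂ) this
    simp only [map_neg, Complex.conj_conj, map_one] at this
    rw [← this]; ring

end

/-! ### Three-term recurrences -/

/-- A solution of a three-term recurrence with constant coefficients is odd about each of its
zeros. -/
theorem recurrence_reflection {f : ℕ → ℂ} {t : ℂ} {N c : ℕ}
    (hf : ∀ p, p + 2 ≤ N → f p + f (p + 2) = t * f (p + 1)) (hc : f c = 0) (k : ℕ) (hk : k ≤ c)
    (hkN : c + k ≤ N) : f (c + k) = -f (c - k) := by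
  induction k using Nat.strong_induction_on with
  | _ k ih =>
    match k, ih with
    | 0, _ => simp [hc]
    | 1, _ =>
      obtain ⟨d, rfl⟩ := Nat.exists_eq_add_of_le' hk
      have := hf d (by omega)
      rw [hc, mul_zero] at this
      exact eq_neg_of_add_eq_zero_right this
    | k + 2, ih =>
      have h1 := ih (k + 1) (by omega) (by omega) (by omega)
      have h2 := ih k (by omega) (by omega) (by omega)
      have e1 := hf (c + k) (by omega)
      have e2 := hf (c - (k + 2)) (by omega)
      rw [show c - (k + 2) + 2 = c - k by omega, show c - (k + 2) + 1 = c - (k + 1) by omega] at e2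
      rw [show c + k + 1 = c + (k + 1) by omega] at e1
      rw [← add_assoc]
      linear_combination e1 + e2 - h2 + t * h1

theorem recurrence_norm_lt {f : ℕ → ℂ} {t : ℝ} {N : ℕ} (ht : 2 ≤ t)
    (hf : ∀ p, p + 2 ≤ N → f p + f (p + 2) = t * f (p + 1)) (h0 : ‖f 0‖ < ‖f 1‖) (p : ℕ)
    (hp : p + 1 ≤ N) : ‖f p‖ < ‖f (p + 1)‖ := by
  induction p with
  | zero => exact h0
  | succ p ih =>
    have ih := ih (by omega)
    have e : (t : ℂ) * f (p + 1) - f p = f (p + 2) := by linear_combination -(hf p hp)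
    have h1 : t * ‖f (p + 1)‖ - ‖f p‖ ≤ ‖f (p + 2)‖ := by
      rw [← e]
      refine le_trans ?_ (norm_sub_norm_le _ _)
      rw [norm_mul, Complex.norm_real, Real.norm_of_nonneg (by linarith)]
    have h2 : 2 * ‖f (p + 1)‖ ≤ t * ‖f (p + 1)‖ :=
      mul_le_mul_of_nonneg_right ht (norm_nonneg _)
    show ‖f (p + 1)‖ < ‖f (p + 2)‖
    linarith

/-! ### The Toeplitz matrix with entries `r ^ |p - q|` -/

/-- The entries of `K x`, with `K = (r ^ |p - q|)`, shifted by one and continued beyond both ends: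
`kmsTransform r x (p + 1)` is entry `p` of `K x`. -/
noncomputable def kmsTransform {n : ℕ} (r : ℝ) (x : Fin n → ℂ) (k : ℕ) : ℂ :=
  ∑ q : Fin n, (r : ℂ) ^ ((k : ℤ) - ((q : ℤ) + 1)).natAbs * x q

section

variable {n : ℕ} {r μ : ℝ} {x : Fin n → ℂ}

theorem kmsTransform_succ (r : ℝ) (x : Fin n → ℂ) (p : Fin n) :
    kmsTransform r x (p + 1) = upperSum r x p + lowerSum r x p + x p := by
  have hx : x p = ∑ i : Fin n, if i = p then x i else 0 := by simp
  rw [upperSum_apply, lowerSum_apply, hx, ← Finset.sum_add_distrib, ← Finset.sum_add_distrib,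
    kmsTransform]
  refine Finset.sum_congr rfl fun i _ => ?_
  rcases lt_trichotomy i p with hi | rfl | hi
  · have h1 : (((p + 1 : ℕ) : ℤ) - ((i : ℤ) + 1)).natAbs = p - i := by
      rw [Fin.lt_def] at hi; omega
    rw [if_neg hi.not_gt, if_pos hi, if_neg hi.ne, h1]; ring
  · simp
  · have h1 : (((p + 1 : ℕ) : ℤ) - ((i : ℤ) + 1)).natAbs = i - p := by
      rw [Fin.lt_def] at hi; omega
    rw [if_pos hi, if_neg hi.not_gt, if_neg hi.ne', h1]; ring

theorem kmsTransform_zero (r : ℝ) (x : Fin n → ℂ) :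
    kmsTransform r x 0 = r * kmsTransform r x 1 := by
  rw [kmsTransform, kmsTransform, Finset.mul_sum]
  refine Finset.sum_congr rfl fun i _ => ?_
  rw [show (((0 : ℕ) : ℤ) - ((i : ℤ) + 1)).natAbs = i + 1 by omega,
    show (((1 : ℕ) : ℤ) - ((i : ℤ) + 1)).natAbs = i by omega]
  ring

theorem kmsTransform_last (r : ℝ) (x : Fin n → ℂ) :
    kmsTransform r x (n + 1) = r * kmsTransform r x n := by
  rw [kmsTransform, kmsTransform, Finset.mul_sum]
  refine Finset.sum_congr rfl fun i _ => ?_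
  have := i.2
  rw [show (((n + 1 : ℕ) : ℤ) - ((i : ℤ) + 1)).natAbs = (n - 1 - i : ℕ) + 1 by omega,
    show (((n : ℕ) : ℤ) - ((i : ℤ) + 1)).natAbs = n - 1 - i by omega]
  ring

/-- The second difference of `r ^ |d|` is concentrated at `d = 0`, so that `K⁻¹` is tridiagonal. -/
theorem kmsTransform_add (hr : r ≠ 0) (x : Fin n → ℂ) (p : Fin n) :
    kmsTransform r x p + kmsTransform r x (p + 2) =
      (r + r⁻¹ : ℝ) * kmsTransform r x (p + 1) + (r - r⁻¹ : ℝ) * x p := by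
  have hr' : (r : ℂ) ≠ 0 := by exact_mod_cast hr
  have hx : x p = ∑ i : Fin n, if i = p then x i else 0 := by simp
  rw [hx]
  simp only [kmsTransform, Finset.mul_sum, ← Finset.sum_add_distrib]
  refine Finset.sum_congr rfl fun i _ => ?_
  push_cast
  rcases lt_trichotomy i p with hi | rfl | hi
  · obtain ⟨d, hd⟩ : ∃ d : ℕ, (p : ℕ) = i + d + 1 := ⟨p - i - 1, by rw [Fin.lt_def] at hi; omega⟩
    rw [if_neg hi.ne, show ((p : ℤ) - ((i : ℤ) + 1)).natAbs = d by omega,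
      show ((p : ℤ) + 2 - ((i : ℤ) + 1)).natAbs = d + 2 by omega,
      show ((p : ℤ) + 1 - ((i : ℤ) + 1)).natAbs = d + 1 by omega]
    field_simp
    ring
  · rw [if_pos rfl, show ((i : ℤ) - ((i : ℤ) + 1)).natAbs = 1 by omega,
      show ((i : ℤ) + 2 - ((i : ℤ) + 1)).natAbs = 1 by omega,
      show ((i : ℤ) + 1 - ((i : ℤ) + 1)).natAbs = 0 by omega]
    field_simp
    ring
  · obtain ⟨d, hd⟩ : ∃ d : ℕ, (i : ℕ) = p + d + 1 := ⟨i - p - 1, by rw [Fin.lt_def] at hi; omega⟩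
    rw [if_neg hi.ne', show ((p : ℤ) - ((i : ℤ) + 1)).natAbs = d + 2 by omega,
      show ((p : ℤ) + 2 - ((i : ℤ) + 1)).natAbs = d by omega,
      show ((p : ℤ) + 1 - ((i : ℤ) + 1)).natAbs = d + 1 by omega]
    field_simp
    ring

theorem kmsTransform_of_mem_ker (hx : kmsPencil n r (-1) μ *ᵥ x = 0) (p : Fin n) :
    kmsTransform r x (p + 1) = (1 - μ) * x p := by
  have := congrFun hx p
  rw [kmsPencil_mulVec] at this
  simp only [map_neg, map_one, Pi.zero_apply] at this
  rw [kmsTransform_succ]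
  linear_combination this

/-- `K` is invertible: `1 - μ = 0` is not an eigenvalue. -/
theorem ne_one_of_mem_ker (hr : 0 < r) (hr1 : r ≠ 1) (hx : kmsPencil n r (-1) μ *ᵥ x = 0)
    (hx0 : x ≠ 0) : μ ≠ 1 := by
  rintro rfl
  have h1 : ∀ k, k < n → kmsTransform r x (k + 1) = 0 := fun k hk => by
    simpa using kmsTransform_of_mem_ker hx ⟨k, hk⟩
  have h2 : ∀ k, k ≤ n + 1 → kmsTransform r x k = 0 := by
    intro k hk
    obtain ⟨i, -⟩ := Function.ne_iff.1 hx0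
    have hi := i.2
    rcases Nat.eq_zero_or_pos k with rfl | hk0
    · rw [kmsTransform_zero, h1 0 (by omega), mul_zero]
    · rcases Nat.lt_or_ge k (n + 1) with hkn | hkn
      · have := h1 (k - 1) (by omega)
        rwa [Nat.sub_add_cancel hk0] at this
      · rw [le_antisymm hk hkn, kmsTransform_last]
        have := h1 (n - 1) (by omega)
        rw [Nat.sub_add_cancel (by omega)] at this
        rw [this, mul_zero]
  apply hx0
  ext i
  have h3 := kmsTransform_add hr.ne' x i
  rw [h2 _ (by omega), h2 _ (by omega), h2 _ (by omega)] at h3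
  have h4 : ((r - r⁻¹ : ℝ) : ℂ) ≠ 0 := by
    rw [Complex.ofReal_ne_zero, sub_ne_zero]
    intro h
    have h5 : r * r = 1 := by
      nth_rw 2 [h]
      exact mul_inv_cancel₀ hr.ne'
    exact hr1 (by nlinarith)
  rw [mul_zero, zero_add, zero_add] at h3
  exact (mul_eq_zero.1 h3.symm).resolve_left h4

theorem kmsTransform_recurrence (hr : r ≠ 0) (hμ : μ ≠ 1) (hx : kmsPencil n r (-1) μ *ᵥ x = 0)
    (p : ℕ) (hp : p + 2 ≤ n + 1) :
    kmsTransform r x p + kmsTransform r x (p + 2) =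
      ((r + r⁻¹ + (r - r⁻¹) / (1 - μ) : ℝ) : ℂ) * kmsTransform r x (p + 1) := by
  have h1 : ((1 : ℂ) - μ) ≠ 0 := by
    rw [sub_ne_zero]; exact_mod_cast hμ.symm
  have h2 := kmsTransform_add hr x ⟨p, by omega⟩
  have h3 := kmsTransform_of_mem_ker hx ⟨p, by omega⟩
  simp only at h2 h3
  have h4 : x ⟨p, by omega⟩ = kmsTransform r x (p + 1) / (1 - μ) := by
    rw [h3]; field_simp
  rw [h2, h4]
  push_cast
  ring

/-- The Hermitian form at the perturbation of a truncated kernel vector by a multiple of the basis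
vector at the cut. -/
theorem cut_form_nonneg (hP : (kmsPencil n r (-1) μ).PosSemidef)
    (hx : kmsPencil n r (-1) μ *ᵥ x = 0) (m : Fin n) (c : ℂ) :
    0 ≤ -((upperSum r x m + x m) * starRingEnd ℂ (lowerSum r x m)) +
      starRingEnd ℂ c * lowerSum r x m + c * starRingEnd ℂ (lowerSum r x m) +
        c * starRingEnd ℂ c * μ := by
  have h0 := hP.dotProduct_mulVec_nonneg (truncBelow m x + Pi.single m c)
  have h1 : star (Pi.single m c) ⬝ᵥ (kmsPencil n r (-1) μ *ᵥ truncBelow m x) =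
      starRingEnd ℂ c * lowerSum r x m := by
    rw [Pi.star_single, single_dotProduct, kmsPencil_mulVec_truncBelow]
    simp
  have h2 : star (truncBelow m x) ⬝ᵥ (kmsPencil n r (-1) μ *ᵥ Pi.single m c) =
      c * starRingEnd ℂ (lowerSum r x m) := by
    have := congrArg star h1
    rw [← Matrix.star_dotProduct_star, star_star, Matrix.star_mulVec,
      (kmsPencil_isHermitian n r (-1) μ).eq, ← Matrix.dotProduct_mulVec] at this
    rw [this]
    simp [mul_comm]
  have h3 : star (Pi.single m c) ⬝ᵥ (kmsPencil n r (-1) μ *ᵥ Pi.single m c) =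
      c * starRingEnd ℂ c * μ := by
    rw [Pi.star_single, single_dotProduct]
    simp [kmsPencil, kmsMatrix]
    ring
  rw [star_add, Matrix.mulVec_add, add_dotProduct, dotProduct_add, dotProduct_add, h1, h2, h3,
    star_truncBelow_dotProduct hx] at h0
  convert h0 using 1
  ring

theorem nonneg_of_nonneg_mul_conj {κ : ℝ} {w : ℂ} (hw : w ≠ 0)
    (h : 0 ≤ (κ : ℂ) * (w * starRingEnd ℂ w)) : 0 ≤ κ := by
  rw [Complex.mul_conj, ← Complex.ofReal_mul, Complex.zero_le_real] at h
  exact nonneg_of_mul_nonneg_left h (Complex.normSq_pos.2 hw)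

/-- Cutting at the zero entry `j` and perturbing by `-∑_{q < j} r ^ (j - q) x_q` there gives
`0 ≤ (μ - 1) |∑_{q < j} r ^ (j - q) x_q|²`. -/
theorem one_lt_of_apply_eq_zero (hr : 0 < r) (hr1 : r ≠ 1)
    (hP : (kmsPencil n r (-1) μ).PosSemidef) (hx : kmsPencil n r (-1) μ *ᵥ x = 0) (hx0 : x ≠ 0)
    {j : Fin n} (hj : x j = 0) : 1 < μ := by
  have hμ1 := ne_one_of_mem_ker hr hr1 hx hx0
  have hL : lowerSum r x j ≠ 0 := by
    intro hL
    rcases eq_neg_or_eq_neg_conj_of_isotropic hr.ne' (by simp) hP hx hx0 (m := j) (Or.inr hj)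
      (by rw [hL]; simp) with h | h <;>
    · apply hμ1
      simpa using h
  have hrow : upperSum r x j = -lowerSum r x j := by
    have := congrFun hx j
    rw [kmsPencil_mulVec, hj] at this
    simp only [map_neg, map_one, Pi.zero_apply] at this
    linear_combination this
  have h := cut_form_nonneg hP hx j (-lowerSum r x j)
  rw [hj, hrow, map_neg] at h
  have : 0 ≤ μ - 1 := by
    refine nonneg_of_nonneg_mul_conj hL ?_
    convert h using 1
    push_cast
    ring
  exact lt_of_le_of_ne (by linarith) hμ1.symm

/-- For `r < 1` the recurrence is expanding, so the entries of an eigenvector grow in modulus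
along the index and cannot vanish. -/
theorem one_lt_base_of_apply_eq_zero (hr : 0 < r) (hr1 : r ≠ 1)
    (hP : (kmsPencil n r (-1) μ).PosSemidef) (hx : kmsPencil n r (-1) μ *ᵥ x = 0) (hx0 : x ≠ 0)
    {j : Fin n} (hj : x j = 0) : 1 < r := by
  have hμ := one_lt_of_apply_eq_zero hr hr1 hP hx hx0 hj
  by_contra hr2
  have hlt : r < 1 := lt_of_le_of_ne (not_lt.1 hr2) hr1
  have hinv : 1 < r⁻¹ := (one_lt_inv₀ hr).2 hlt
  -- here `1 - μ < 0` and `r < r⁻¹`, so the coefficient exceeds `r + r⁻¹ ≥ 2`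
  have ht : 2 ≤ r + r⁻¹ + (r - r⁻¹) / (1 - μ) := by
    have h1 : 0 ≤ (r - r⁻¹) / (1 - μ) := div_nonneg_of_nonpos (by linarith) (by linarith)
    have h2 : r * r⁻¹ = 1 := mul_inv_cancel₀ hr.ne'
    nlinarith [sq_nonneg (r - 1), sq_nonneg (r⁻¹ - 1)]
  have hn : 0 < n := Fin.pos j
  have hf0 : kmsTransform r x 1 ≠ 0 := by
    intro h
    have h1 := kmsTransform_of_mem_ker hx ⟨0, hn⟩
    simp only [zero_add] at h1
    rw [h, eq_comm, mul_eq_zero] at h1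
    have h2 : ((1 : ℂ) - μ) ≠ 0 := by
      rw [sub_ne_zero]; exact_mod_cast hμ.ne
    have h3 := eq_neg_of_first_eq_zero hr.ne' (by simp) hx hx0 fun i hi => by
      rw [← h1.resolve_left h2]; congr 1; exact Fin.ext hi
    have : μ = 1 := by simpa using h3
    exact hμ.ne' this
  have h01 : ‖kmsTransform r x 0‖ < ‖kmsTransform r x 1‖ := by
    rw [kmsTransform_zero, norm_mul, Complex.norm_real, Real.norm_of_nonneg hr.le]
    nlinarith [norm_pos_iff.2 hf0]
  have := recurrence_norm_lt ht (kmsTransform_recurrence hr.ne' hμ.ne' hx) h01 j (by omega)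
  rw [kmsTransform_of_mem_ker hx, hj, mul_zero, norm_zero] at this
  exact absurd this (norm_nonneg _).not_gt

theorem kmsTransform_reflection (hr : 0 < r) (hμ : μ ≠ 1) (hx : kmsPencil n r (-1) μ *ᵥ x = 0)
    {j : Fin n} (hj : x j = 0) (k : ℕ) (hk : k ≤ j + 1) (hkn : j + 1 + k ≤ n + 1) :
    kmsTransform r x (j + 1 + k) = -kmsTransform r x (j + 1 - k) :=
  recurrence_reflection (kmsTransform_recurrence hr.ne' hμ hx)
    (by rw [kmsTransform_of_mem_ker hx, hj, mul_zero]) k hk hkn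

/-- A zero entry of a minimizing eigenvector does not lie left of the centre: otherwise the
reflected boundary condition holds in the interior, and cutting there splits off a kernel vector
that vanishes at the last index. -/
theorem le_two_mul_add_one_of_apply_eq_zero (hr : 0 < r) (hr1 : r ≠ 1)
    (hP : (kmsPencil n r (-1) μ).PosSemidef) (hx : kmsPencil n r (-1) μ *ᵥ x = 0) (hx0 : x ≠ 0)
    {j : Fin n} (hj : x j = 0) : n ≤ 2 * j + 1 := by
  by_contra hlt
  have hμ := ne_one_of_mem_ker hr hr1 hx hx0
  let m : Fin n := ⟨2 * j + 1, by omega⟩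
  let l : Fin n := ⟨2 * j, by omega⟩
  have h1 := kmsTransform_reflection hr hμ hx hj (j + 1) le_rfl (by omega)
  have h2 := kmsTransform_reflection hr hμ hx hj j (by omega) (by omega)
  rw [Nat.sub_self, kmsTransform_zero] at h1
  rw [Nat.add_sub_cancel_left] at h2
  have h3 : kmsTransform r x (m + 1) = r * kmsTransform r x (l + 1) := by
    have e1 : (m : ℕ) + 1 = j + 1 + (j + 1) := by simp only [m]; ring
    have e2 : (l : ℕ) + 1 = j + 1 + j := by simp only [l]; ring
    rw [e1, e2, h1, h2]; ring
  have hlm : (l : ℕ) + 1 = m := rfl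
  rw [kmsTransform_succ, kmsTransform_succ, lowerSum_succ r x hlm, upperSum_pred r x hlm] at h3
  have h4 : upperSum r x m + x m = 0 := by
    have h5 : ((1 - r ^ 2 : ℝ) : ℂ) * (upperSum r x m + x m) = 0 := by
      push_cast
      linear_combination h3
    refine (mul_eq_zero.1 h5).resolve_left ?_
    rw [Complex.ofReal_eq_zero]
    intro h
    exact hr1 (by nlinarith)
  rcases eq_neg_or_eq_neg_conj_of_isotropic hr.ne' (by simp) hP hx hx0 (m := m)
    (Or.inl (Nat.succ_ne_zero _)) (by rw [h4, zero_mul]) with h | h <;>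
  · apply hμ
    simpa using h

/-- A zero entry of a minimizing eigenvector is the central one. -/
theorem eq_two_mul_add_one_of_apply_eq_zero (hr : 0 < r) (hr1 : r ≠ 1)
    (hP : (kmsPencil n r (-1) μ).PosSemidef) (hx : kmsPencil n r (-1) μ *ᵥ x = 0) (hx0 : x ≠ 0)
    {j : Fin n} (hj : x j = 0) : n = 2 * j + 1 := by
  have h1 := le_two_mul_add_one_of_apply_eq_zero hr hr1 hP hx hx0 hj
  have hx' : kmsPencil n r (-1) μ *ᵥ (x ∘ Fin.rev) = 0 := by
    simpa using kmsPencil_mulVec_rev_eq_zero hx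
  have h2 := le_two_mul_add_one_of_apply_eq_zero hr hr1 hP hx' (j := j.rev)
    (fun h => hx0 (by ext i; simpa using congrFun h i.rev)) (by simpa using hj)
  rw [Fin.val_rev] at h2
  omega

theorem comp_rev_eq_neg_of_apply_eq_zero (hr : 0 < r) (hμ : μ ≠ 1)
    (hx : kmsPencil n r (-1) μ *ᵥ x = 0) {j : Fin n} (hjn : n = 2 * j + 1) (hj : x j = 0)
    (i : Fin n) : x i.rev = -x i := by
  wlog hij : j ≤ i generalizing i
  · have hle : j ≤ i.rev := by
      rw [Fin.le_def, Fin.val_rev]; rw [Fin.le_def] at hij; omega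
    have := this i.rev hle
    rw [Fin.rev_rev] at this
    rw [this, neg_neg]
  · rw [Fin.le_def] at hij
    have hi := i.2
    have h := kmsTransform_reflection hr hμ hx hj (i - j) (by omega) (by omega)
    have e1 : (j : ℕ) + 1 + (i - j) = i + 1 := by omega
    have e2 : (j : ℕ) + 1 - (i - j) = i.rev + 1 := by rw [Fin.val_rev]; omega
    rw [e1, e2, kmsTransform_of_mem_ker hx, kmsTransform_of_mem_ker hx] at h
    have h1 : ((1 : ℂ) - μ) ≠ 0 := by
      rw [sub_ne_zero]; exact_mod_cast hμ.symm
    have : ((1 : ℂ) - μ) * (x i.rev + x i) = 0 := by linear_combination h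
    exact eq_neg_of_add_eq_zero_left ((mul_eq_zero.1 this).resolve_left h1)

theorem one_lt_of_posSemidef (hn : 2 ≤ n) (hr : 1 < r) (hP : (kmsPencil n r (-1) μ).PosSemidef) :
    1 < μ := by
  let p : Fin n := ⟨0, by omega⟩
  let q : Fin n := ⟨1, by omega⟩
  have hpq : p < q := by rw [Fin.lt_def]; exact zero_lt_one
  have h := hP.dotProduct_mulVec_nonneg (Pi.single p 1 - Pi.single q 1)
  have : (0 : ℂ) ≤ ((2 * (μ - r) : ℝ) : ℂ) := by
    convert h using 1
    simp [Matrix.mulVec_sub, sub_dotProduct, dotProduct_sub, kmsPencil, kmsMatrix, hpq, hpq.ne,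
      hpq.ne', hpq.not_gt]
    simp [p, q]
    ring
  rw [Complex.zero_le_real] at this
  linarith

/-- For `r > 1` and odd size, the least eigenvalue of `Re J` has an eigenvector vanishing at the
centre. The antisymmetric part of any eigenvector serves, unless the eigenvector is symmetric, in
which case flipping the sign of one half lowers the form. -/
theorem exists_mem_ker_apply_eq_zero (hn : 2 ≤ n) (hr : 1 < r)
    (hP : (kmsPencil n r (-1) μ).PosSemidef) (hx : kmsPencil n r (-1) μ *ᵥ x = 0) (hx0 : x ≠ 0)
    {j : Fin n} (hjn : n = 2 * j + 1) :
    ∃ y : Fin n → ℂ, y ≠ 0 ∧ kmsPencil n r (-1) μ *ᵥ y = 0 ∧ y j = 0 := by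
  have hjr : j.rev = j := Fin.ext (by rw [Fin.val_rev]; omega)
  have hx' : kmsPencil n r (-1) μ *ᵥ (x ∘ Fin.rev) = 0 := by
    simpa using kmsPencil_mulVec_rev_eq_zero hx
  by_cases hsym : x = x ∘ Fin.rev
  · exfalso
    have hμ := one_lt_of_posSemidef hn hr hP
    have hr0 : 0 < r := by linarith
    have hxj : x j ≠ 0 := by
      intro hj
      apply hx0
      ext i
      have h1 := comp_rev_eq_neg_of_apply_eq_zero hr0 hμ.ne' hx hjn hj i
      have h2 := congrFun hsym i
      simp only [Function.comp] at h2
      simp only [Pi.zero_apply]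
      linear_combination (1 / 2) * h2 + (1 / 2) * h1
    have hUL : upperSum r x j = lowerSum r x j := by
      conv_lhs => rw [hsym, upperSum_rev, hjr]
    have hL : lowerSum r x j = ((-μ / 2 : ℝ) : ℂ) * x j := by
      have := congrFun hx j
      rw [kmsPencil_mulVec, hUL] at this
      simp only [map_neg, map_one, Pi.zero_apply] at this
      push_cast
      linear_combination (1 / 2) * this
    have h := cut_form_nonneg hP hx j (x j / 2)
    rw [hUL, hL, map_mul, Complex.conj_ofReal, map_div₀, Complex.conj_ofNat] at h
    have h1 : 0 ≤ μ * (1 - μ) / 4 := by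
      refine nonneg_of_nonneg_mul_conj hxj ?_
      convert h using 1
      push_cast
      ring
    nlinarith
  · refine ⟨x - x ∘ Fin.rev, sub_ne_zero.2 hsym, ?_, ?_⟩
    · rw [Matrix.mulVec_sub, hx, hx', sub_zero]
    · simp [hjr]

end

/-! ### Diagonal unitary similarity -/

section

variable {ι : Type*} [Fintype ι] {A B : Matrix ι ι ℂ} {d : ι → ℂ}

theorem star_mul_dotProduct_mul (hd : ∀ i, starRingEnd ℂ (d i) * d i = 1) (x : ι → ℂ) :
    star (d * x) ⬝ᵥ (d * x) = star x ⬝ᵥ x := by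
  refine Finset.sum_congr rfl fun i _ => ?_
  simp only [Pi.star_apply, Pi.mul_apply, star_mul', Complex.star_def]
  linear_combination (starRingEnd ℂ (x i) * x i) * hd i

theorem star_dotProduct_mulVec_of_similar
    (hAB : ∀ i k, A i k = starRingEnd ℂ (d i) * B i k * d k) (x : ι → ℂ) :
    star x ⬝ᵥ (A *ᵥ x) = star (d * x) ⬝ᵥ (B *ᵥ (d * x)) := by
  refine Finset.sum_congr rfl fun i _ => ?_
  simp only [Pi.star_apply, Pi.mul_apply, star_mul', Matrix.mulVec, dotProduct, hAB, Finset.mul_sum]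
  refine Finset.sum_congr rfl fun k _ => ?_
  simp only [Complex.star_def]
  ring

variable [DecidableEq ι]

theorem numericalRange_subset_of_similar (hd : ∀ i, starRingEnd ℂ (d i) * d i = 1)
    (hAB : ∀ i k, A i k = starRingEnd ℂ (d i) * B i k * d k) :
    numericalRange A ⊆ numericalRange B := by
  intro z hz
  obtain ⟨x, hx, rfl⟩ := mem_numericalRange_iff.1 hz
  exact mem_numericalRange_iff.2 ⟨d * x, (star_mul_dotProduct_mul hd x).trans hx,
    star_dotProduct_mulVec_of_similar hAB x⟩

theorem numericalRange_eq_of_similar (hd : ∀ i, starRingEnd ℂ (d i) * d i = 1)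
    (hAB : ∀ i k, A i k = starRingEnd ℂ (d i) * B i k * d k) :
    numericalRange A = numericalRange B := by
  refine (numericalRange_subset_of_similar hd hAB).antisymm
    (numericalRange_subset_of_similar (d := fun i => starRingEnd ℂ (d i)) (fun i => ?_)
      fun i k => ?_)
  · rw [Complex.conj_conj, mul_comm]; exact hd i
  · rw [Complex.conj_conj, hAB]
    linear_combination -(B i k) * hd i * (starRingEnd ℂ (d k) * d k) - (B i k) * hd k

end

/-- The diagonal entries of the unitary matrix taking `J_n(a)` to `J_n(|a|)`. -/
noncomputable def kmsPhase (n : ℕ) (a : ℂ) : Fin n → ℂ := fun k => (a / ‖a‖) ^ (k : ℕ)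

theorem conj_div_norm_mul_self {a : ℂ} (ha : a ≠ 0) :
    starRingEnd ℂ (a / ‖a‖) * (a / ‖a‖) = 1 := by
  have hn : (‖a‖ : ℂ) ≠ 0 := by exact_mod_cast norm_ne_zero_iff.2 ha
  rw [map_div₀, Complex.conj_ofReal, div_mul_div_comm, mul_comm, Complex.mul_conj,
    Complex.normSq_eq_norm_sq]
  push_cast
  field_simp

theorem conj_kmsPhase_mul_self {n : ℕ} {a : ℂ} (ha : a ≠ 0) (k : Fin n) :
    starRingEnd ℂ (kmsPhase n a k) * kmsPhase n a k = 1 := by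
  rw [kmsPhase, map_pow, ← mul_pow, conj_div_norm_mul_self ha, one_pow]

/-- `J_n(a)` is similar to `J_n(|a|)` by the diagonal unitary matrix with entries
`kmsPhase n a`. -/
theorem kmsMatrix_apply_eq {a : ℂ} (ha : a ≠ 0) {n : ℕ} (i k : Fin n) :
    kmsMatrix n a i k =
      starRingEnd ℂ (kmsPhase n a i) * kmsMatrix n ((‖a‖ : ℝ) : ℂ) i k * kmsPhase n a k := by
  have hn : (‖a‖ : ℂ) ≠ 0 := by exact_mod_cast norm_ne_zero_iff.2 ha
  have hu := conj_div_norm_mul_self ha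
  simp only [kmsMatrix, Matrix.of_apply, kmsPhase]
  split_ifs with h
  · obtain ⟨m, hm⟩ := Nat.exists_eq_add_of_lt (Fin.lt_def.1 h)
    have hm' : (k : ℕ) - i = m + 1 := by omega
    have ha' : a = a / ‖a‖ * ‖a‖ := by field_simp
    rw [hm', show (k : ℕ) = i + (m + 1) by omega, pow_add (a / (‖a‖ : ℂ)), map_pow]
    generalize a / (‖a‖ : ℂ) = u at *
    calc a ^ (m + 1) = (u * ‖a‖) ^ (m + 1) := by rw [← ha']
      _ = (starRingEnd ℂ u * u) ^ (i : ℕ) * (u * ‖a‖) ^ (m + 1) := by rw [hu, one_pow, one_mul]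
      _ = _ := by rw [mul_pow, mul_pow]; ring
  · simp

theorem realPart_kmsMatrix_mulVec {n : ℕ} {a : ℂ} (ha : a ≠ 0) (x : Fin n → ℂ) (i : Fin n) :
    ((ℜ (kmsMatrix n a) : Matrix (Fin n) (Fin n) ℂ) *ᵥ x) i =
      starRingEnd ℂ (kmsPhase n a i) * ((1 / 2) *
        (upperSum ‖a‖ (kmsPhase n a * x) i + lowerSum ‖a‖ (kmsPhase n a * x) i)) := by
  have hreal : ∀ i k, starRingEnd ℂ (kmsMatrix n ((‖a‖ : ℝ) : ℂ) i k) =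
      kmsMatrix n ((‖a‖ : ℝ) : ℂ) i k := by
    intro i k
    simp only [kmsMatrix, Matrix.of_apply]
    split_ifs <;> simp
  rw [realPart_apply_coe, upperSum, lowerSum]
  simp only [Matrix.mulVec, dotProduct, ← Finset.sum_add_distrib, Finset.mul_sum]
  refine Finset.sum_congr rfl fun k _ => ?_
  simp only [Matrix.smul_apply, Matrix.add_apply, Matrix.star_apply, Matrix.transpose_apply,
    Pi.mul_apply, kmsMatrix_apply_eq ha i k, kmsMatrix_apply_eq ha k i, star_mul', Complex.star_def,
    Complex.conj_conj, hreal, kmsPhase, Complex.real_smul]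
  push_cast
  ring

/-! ### The numerical range of `J_n(r)` and the pencil -/

section

variable {n : ℕ} {r μ : ℝ} {ω z : ℂ} {x : Fin n → ℂ}

theorem conj_star_dotProduct_kmsMatrix (r : ℝ) (x : Fin n → ℂ) :
    starRingEnd ℂ (star x ⬝ᵥ (kmsMatrix n (r : ℂ) *ᵥ x)) =
      star x ⬝ᵥ ((kmsMatrix n (r : ℂ))ᵀ *ᵥ x) := by
  have h : (kmsMatrix n (r : ℂ))ᴴ = (kmsMatrix n (r : ℂ))ᵀ := by
    ext i k
    simp only [kmsMatrix, Matrix.conjTranspose_apply, Matrix.transpose_apply, Matrix.of_apply]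
    split_ifs <;> simp
  rw [starRingEnd_apply, ← Matrix.star_dotProduct_star, star_star, Matrix.star_mulVec, h,
    ← Matrix.dotProduct_mulVec]

theorem star_dotProduct_kmsPencil (r μ : ℝ) (ω : ℂ) (x : Fin n → ℂ) :
    star x ⬝ᵥ (kmsPencil n r ω μ *ᵥ x) = μ * (star x ⬝ᵥ x) -
      ((2 * (ω * (star x ⬝ᵥ (kmsMatrix n (r : ℂ) *ᵥ x))).re : ℝ) : ℂ) := by
  rw [← Complex.add_conj, map_mul, conj_star_dotProduct_kmsMatrix]
  simp [kmsPencil, Matrix.sub_mulVec, Matrix.add_mulVec, Matrix.smul_mulVec, dotProduct_sub,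
    dotProduct_add]

/-- A supporting line of `W(J)` gives a positive semidefinite pencil. -/
theorem kmsPencil_posSemidef {c : ℝ}
    (h : ∀ w ∈ numericalRange (kmsMatrix n (r : ℂ)), (ω * w).re ≤ c) :
    (kmsPencil n r ω (2 * c)).PosSemidef := by
  refine .of_dotProduct_mulVec_nonneg (kmsPencil_isHermitian n r ω _) fun x => ?_
  by_cases hx : x = 0
  · simp [hx]
  obtain ⟨s, hs, hxs⟩ : ∃ s : ℝ, 0 < s ∧ star x ⬝ᵥ x = ((s ^ 2 : ℝ) : ℂ) := by
    refine ⟨‖WithLp.toLp 2 x‖, norm_pos_iff.2 (by simpa using hx), ?_⟩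
    have := inner_self_eq_norm_sq_to_K (𝕜 := ℂ) (WithLp.toLp 2 x)
    rw [EuclideanSpace.inner_eq_star_dotProduct, dotProduct_comm] at this
    rw [this]; push_cast; rfl
  have hs' : (s : ℂ) ≠ 0 := by exact_mod_cast hs.ne'
  have hw := h _ (mem_numericalRange_iff.2 ⟨((s⁻¹ : ℝ) : ℂ) • x, by
    rw [star_smul, smul_dotProduct, dotProduct_smul, hxs]
    simp
    field_simp, rfl⟩)
  rw [star_smul, Matrix.mulVec_smul, smul_dotProduct, dotProduct_smul, Complex.star_def,
    Complex.conj_ofReal, smul_eq_mul, smul_eq_mul, mul_left_comm, Complex.re_ofReal_mul,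
    mul_left_comm, Complex.re_ofReal_mul] at hw
  rw [star_dotProduct_kmsPencil, hxs, ← Complex.ofReal_mul, ← Complex.ofReal_sub,
    Complex.zero_le_real]
  have h2 := mul_le_mul_of_nonneg_left hw (sq_nonneg s)
  have h3 : ∀ q : ℝ, s ^ 2 * (s⁻¹ * (s⁻¹ * q)) = q := fun q => by field_simp
  rw [h3] at h2
  linarith

/-- A unit vector attaining the support value lies in the kernel. -/
theorem kmsPencil_mulVec_eq_zero (hx : star x ⬝ᵥ x = 1)
    (hz : z = star x ⬝ᵥ (kmsMatrix n (r : ℂ) *ᵥ x))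
    (h : ∀ w ∈ numericalRange (kmsMatrix n (r : ℂ)), (ω * w).re ≤ (ω * z).re) :
    kmsPencil n r ω (2 * (ω * z).re) *ᵥ x = 0 := by
  rw [← (kmsPencil_posSemidef h).dotProduct_mulVec_zero_iff, star_dotProduct_kmsPencil, hx, ← hz]
  simp

/-- `-μ / 2` is the least eigenvalue of `Re J_n(r)`, with an eigenvector in the kernel of the
pencil. -/
theorem exists_posSemidef_and_mem_ker (hn : 0 < n) (r : ℝ) :
    ∃ μ : ℝ, (kmsPencil n r (-1) μ).PosSemidef ∧
      ∃ x : Fin n → ℂ, x ≠ 0 ∧ kmsPencil n r (-1) μ *ᵥ x = 0 := by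
  have hne : (numericalRange (kmsMatrix n (r : ℂ))).Nonempty :=
    ⟨_, mem_numericalRange_iff.2 ⟨Pi.single ⟨0, hn⟩ 1, by simp, rfl⟩⟩
  obtain ⟨z, hz, hmin⟩ := (isCompact_numericalRange (kmsMatrix n (r : ℂ))).exists_isMinOn hne
    Complex.continuous_re.continuousOn
  have h : ∀ w ∈ numericalRange (kmsMatrix n (r : ℂ)), (-1 * w).re ≤ (-1 * z).re := fun w hw => by
    have := hmin hw
    simpa using this
  obtain ⟨x, hx, hzx⟩ := mem_numericalRange_iff.1 hz
  refine ⟨_, kmsPencil_posSemidef h, x, ?_, kmsPencil_mulVec_eq_zero hx hzx h⟩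
  rintro rfl
  simp at hx

theorem le_of_posSemidef_of_mem_ker {ν : ℝ} (hP : (kmsPencil n r ω μ).PosSemidef)
    (hx : kmsPencil n r ω ν *ᵥ x = 0) (hx0 : x ≠ 0) : ν ≤ μ := by
  have h := hP.dotProduct_mulVec_nonneg x
  have h1 : kmsPencil n r ω μ *ᵥ x = ((μ - ν : ℝ) : ℂ) • x := by
    have : kmsPencil n r ω μ = kmsPencil n r ω ν + ((μ - ν : ℝ) : ℂ) • 1 := by
      simp only [kmsPencil]
      push_cast
      module
    rw [this, Matrix.add_mulVec, hx, Matrix.smul_mulVec, Matrix.one_mulVec, zero_add]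
  rw [h1, dotProduct_smul, smul_eq_mul] at h
  have hpos : 0 < (star x ⬝ᵥ x).re :=
    (Complex.lt_def.1 (Matrix.dotProduct_star_self_pos_iff.2 hx0)).1
  have h2 := (Complex.le_def.1 h).1
  rw [Complex.re_ofReal_mul, Complex.zero_re] at h2
  linarith [nonneg_of_mul_nonneg_left h2 hpos]

/-- The form of `J_n(r)` is real on antisymmetric vectors, since reversal of the indices
transposes `J_n(r)`. -/
theorem star_dotProduct_kmsMatrix_im_eq_zero (r : ℝ) (hx : ∀ i, x i.rev = -x i) :
    (star x ⬝ᵥ (kmsMatrix n (r : ℂ) *ᵥ x)).im = 0 := by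
  rw [← Complex.conj_eq_iff_im, conj_star_dotProduct_kmsMatrix]
  have hxr : x ∘ Fin.rev = -x := funext hx
  refine Fintype.sum_equiv Fin.revPerm _ _ fun i => ?_
  simp only [Pi.star_apply, Fin.revPerm_apply, hx]
  have h := upperSum_rev r x i.rev
  rw [Fin.rev_rev, hxr] at h
  change star (x i) * lowerSum r x i = star (-x i) * upperSum r x i.rev
  rw [← h, upperSum, upperSum, Matrix.mulVec_neg, star_neg]
  simp

/-- Every point of `∂W(J) ∩ W(J[j])` is the least eigenvalue of `Re J`, attained at an
antisymmetric eigenvector. -/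
theorem exists_of_mem_frontier_inter (hr : 0 < r) (hr1 : r ≠ 1)
    (hP : (kmsPencil n r (-1) μ).PosSemidef) {y : Fin n → ℂ} (hy0 : y ≠ 0)
    (hy : kmsPencil n r (-1) μ *ᵥ y = 0) {j : Fin n}
    (hz : z ∈ frontier (numericalRange (kmsMatrix n (r : ℂ))))
    (hzj : z ∈ numericalRange (principalSubmatrix (kmsMatrix n (r : ℂ)) j)) :
    1 < r ∧ n = 2 * j + 1 ∧ z = ((-μ / 2 : ℝ) : ℂ) ∧
      ∃ x : Fin n → ℂ, star x ⬝ᵥ x = 1 ∧ x j = 0 ∧ (∀ i, x i.rev = -x i) ∧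
        kmsPencil n r (-1) μ *ᵥ x = 0 ∧ z = star x ⬝ᵥ (kmsMatrix n (r : ℂ) *ᵥ x) := by
  obtain ⟨x, hxj, hx, hzx⟩ := mem_numericalRange_principalSubmatrix_iff.1 hzj
  obtain ⟨ω, hω, hsupp⟩ := exists_norm_eq_one_re_mul_le (convex_numericalRange _)
    (mem_numericalRange_iff.2 ⟨x, hx, hzx⟩) hz
  have hx0 : x ≠ 0 := by rintro rfl; simp at hx
  have hQ := kmsPencil_posSemidef hsupp
  have hker := kmsPencil_mulVec_eq_zero hx hzx hsupp
  obtain rfl := eq_neg_one_of_apply_eq_zero hr.ne' hω hQ hker hx0 hxj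
  have hμ : 2 * (-1 * z).re = μ :=
    (le_of_posSemidef_of_mem_ker hP hker hx0).antisymm (le_of_posSemidef_of_mem_ker hQ hy hy0)
  rw [hμ] at hker
  have hjn := eq_two_mul_add_one_of_apply_eq_zero hr hr1 hP hker hx0 hxj
  have hanti := comp_rev_eq_neg_of_apply_eq_zero hr (ne_one_of_mem_ker hr hr1 hker hx0) hker hjn hxj
  refine ⟨one_lt_base_of_apply_eq_zero hr hr1 hP hker hx0 hxj, hjn, ?_, x, hx, hxj, hanti, hker,
    hzx⟩
  apply Complex.ext
  · rw [Complex.ofReal_re, ← hμ]; simp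
  · rw [hzx, star_dotProduct_kmsMatrix_im_eq_zero r hanti, Complex.ofReal_im]

/-- For `r > 1` and odd `n`, the least eigenvalue `-μ / 2` of `Re J` lies in `∂W(J) ∩ W(J[j])` at
the central `j`. -/
theorem mem_frontier_inter (hn : 2 ≤ n) (hr : 1 < r) (hP : (kmsPencil n r (-1) μ).PosSemidef)
    {y : Fin n → ℂ} (hy0 : y ≠ 0) (hy : kmsPencil n r (-1) μ *ᵥ y = 0) {j : Fin n}
    (hjn : n = 2 * j + 1) :
    ((-μ / 2 : ℝ) : ℂ) ∈ frontier (numericalRange (kmsMatrix n (r : ℂ))) ∩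
      numericalRange (principalSubmatrix (kmsMatrix n (r : ℂ)) j) := by
  obtain ⟨x, hx0, hker, hxj⟩ := exists_mem_ker_apply_eq_zero hn hr hP hy hy0 hjn
  have hr0 : 0 < r := by linarith
  obtain ⟨x, hx, hker, hxj⟩ : ∃ x : Fin n → ℂ,
      star x ⬝ᵥ x = 1 ∧ kmsPencil n r (-1) μ *ᵥ x = 0 ∧ x j = 0 := by
    have hs : ‖WithLp.toLp 2 x‖ ≠ 0 := norm_ne_zero_iff.2 (by simpa using hx0)
    refine ⟨((‖WithLp.toLp 2 x‖ : ℂ)⁻¹) • x, ?_, ?_, ?_⟩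
    · rw [← norm_eq_one_iff_dotProduct (WithLp.toLp 2 (((‖WithLp.toLp 2 x‖ : ℂ)⁻¹) • x)),
        WithLp.toLp_smul, norm_smul, norm_inv, Complex.norm_real, norm_norm, inv_mul_cancel₀ hs]
    · rw [Matrix.mulVec_smul, hker, smul_zero]
    · simp [hxj]
  have hx0 : x ≠ 0 := by rintro rfl; simp at hx
  have hanti := comp_rev_eq_neg_of_apply_eq_zero hr0 (one_lt_of_posSemidef hn hr hP).ne' hker hjn hxj
  have hb : ((-μ / 2 : ℝ) : ℂ) = star x ⬝ᵥ (kmsMatrix n (r : ℂ) *ᵥ x) := by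
    have h := star_dotProduct_kmsPencil r μ (-1) x
    rw [hker, dotProduct_zero, hx, mul_one, ← Complex.ofReal_sub, eq_comm,
      Complex.ofReal_eq_zero] at h
    apply Complex.ext
    · rw [Complex.ofReal_re]
      simp only [neg_mul, one_mul, Complex.neg_re] at h
      linarith
    · rw [star_dotProduct_kmsMatrix_im_eq_zero r hanti, Complex.ofReal_im]
  refine ⟨⟨subset_closure (mem_numericalRange_iff.2 ⟨x, hx, hb⟩), fun hint => ?_⟩,
    mem_numericalRange_principalSubmatrix_iff.2 ⟨x, hxj, hx, hb⟩⟩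
  have hsub : numericalRange (kmsMatrix n (r : ℂ)) ⊆ {w : ℂ | -μ / 2 ≤ w.re} := by
    intro w hw
    obtain ⟨v, hv, rfl⟩ := mem_numericalRange_iff.1 hw
    have h := hP.dotProduct_mulVec_nonneg v
    rw [star_dotProduct_kmsPencil, hv, mul_one, ← Complex.ofReal_sub, Complex.zero_le_real] at h
    simp only [neg_mul, one_mul, Complex.neg_re] at h
    show -μ / 2 ≤ _
    linarith
  have := interior_mono hsub hint
  rw [Complex.interior_setOfPred_le_re] at this
  have h : -μ / 2 < ((-μ / 2 : ℝ) : ℂ).re := this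
  rw [Complex.ofReal_re] at h
  exact lt_irrefl _ h

end

/-! ### The spectrum of `Re J_n(a)` -/

theorem mem_spectrum_matrix_iff {n : ℕ} {A : Matrix (Fin n) (Fin n) ℂ} {z : ℂ} :
    z ∈ spectrum ℂ A ↔ ∃ v : Fin n → ℂ, v ≠ 0 ∧ A *ᵥ v = z • v := by
  rw [← Matrix.spectrum_toLin', ← Module.End.hasEigenvalue_iff_mem_spectrum]
  constructor
  · intro h
    obtain ⟨v, hv⟩ := h.exists_hasEigenvector
    exact ⟨v, hv.2, by simpa using hv.apply_eq_smul⟩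
  · rintro ⟨v, hv0, hv⟩
    exact Module.End.hasEigenvalue_of_hasEigenvector
      ⟨Module.End.mem_eigenspace_iff.2 (by simpa using hv), hv0⟩

/-- Eigenvectors of `Re J_n(a)` in terms of the sums attached to `J_n(|a|)`. -/
theorem realPart_kmsMatrix_mulVec_eq_smul_iff {n : ℕ} {a : ℂ} (ha : a ≠ 0) {z : ℂ}
    (x : Fin n → ℂ) :
    (ℜ (kmsMatrix n a) : Matrix (Fin n) (Fin n) ℂ) *ᵥ x = z • x ↔
      ∀ i, upperSum ‖a‖ (kmsPhase n a * x) i + lowerSum ‖a‖ (kmsPhase n a * x) i =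
        2 * z * (kmsPhase n a * x) i := by
  rw [funext_iff]
  refine forall_congr' fun i => ?_
  rw [realPart_kmsMatrix_mulVec ha]
  have hd := conj_kmsPhase_mul_self ha i
  simp only [Pi.smul_apply, Pi.mul_apply, smul_eq_mul]
  constructor
  · intro h
    linear_combination 2 * kmsPhase n a i * h -
      (upperSum ‖a‖ (kmsPhase n a * x) i + lowerSum ‖a‖ (kmsPhase n a * x) i) * hd
  · intro h
    linear_combination (1 / 2) * starRingEnd ℂ (kmsPhase n a i) * h + z * x i * hd

theorem im_eq_zero_and_le_re_of_mem_spectrum {n : ℕ} {a : ℂ} (ha : a ≠ 0) {μ : ℝ}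
    (hP : (kmsPencil n ‖a‖ (-1) μ).PosSemidef) {z : ℂ}
    (hz : z ∈ spectrum ℂ (ℜ (kmsMatrix n a) : Matrix (Fin n) (Fin n) ℂ)) :
    z.im = 0 ∧ -μ / 2 ≤ z.re := by
  obtain ⟨v, hv0, hv⟩ := mem_spectrum_matrix_iff.1 hz
  rw [realPart_kmsMatrix_mulVec_eq_smul_iff ha] at hv
  set w := kmsPhase n a * v with hw
  have hPw : kmsPencil n ‖a‖ (-1) μ *ᵥ w = ((μ : ℂ) + 2 * z) • w := by
    ext i
    rw [kmsPencil_mulVec]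
    simp only [map_neg, map_one, Pi.smul_apply, smul_eq_mul]
    linear_combination hv i
  have h := hP.dotProduct_mulVec_nonneg w
  rw [hPw, dotProduct_smul, smul_eq_mul, hw, star_mul_dotProduct_mul (conj_kmsPhase_mul_self ha)]
    at h
  have hpos : 0 < star v ⬝ᵥ v := Matrix.dotProduct_star_self_pos_iff.2 hv0
  obtain ⟨hre, him⟩ := Complex.lt_def.1 hpos
  obtain ⟨h1, h2⟩ := Complex.le_def.1 h
  simp only [Complex.mul_re, Complex.mul_im, Complex.add_re, Complex.add_im, Complex.ofReal_re,
    Complex.ofReal_im, Complex.zero_re, Complex.zero_im, ← him, Complex.re_ofNat,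
    Complex.im_ofNat] at h1 h2 hre
  constructor
  · have h3 : z.im * (star v ⬝ᵥ v).re = 0 := by linarith
    exact (mul_eq_zero.1 h3).resolve_right hre.ne'
  · have h3 : 0 ≤ (μ + 2 * z.re) * (star v ⬝ᵥ v).re := by linarith
    linarith [nonneg_of_mul_nonneg_left h3 hre]

/-! ### The common boundary of `W(J_n(a))` and `W(J_n(a)[j])` -/

theorem theorem3p8 (n : ℕ) (hn : 2 ≤ n) (a : ℂ) (ha0 : ‖a‖ ≠ 0) (ha1 : ‖a‖ ≠ 1) :
    -- `b` is the least element of the spectrum of `Re J_n(a)` (all of which is real)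
    ∃ b : ℝ,
      (b : ℂ) ∈ spectrum ℂ (ℜ (kmsMatrix n a) : Matrix (Fin n) (Fin n) ℂ) ∧
      (∀ z ∈ spectrum ℂ (ℜ (kmsMatrix n a) : Matrix (Fin n) (Fin n) ℂ), z.im = 0 ∧ b ≤ z.re) ∧
      -- the index `j : Fin n` stands for row and column number `j + 1`
      ∀ j : Fin n,
        (Odd n ∧ (j : ℕ) + 1 = (n + 1) / 2 ∧ 1 < ‖a‖ →
          frontier (numericalRange (kmsMatrix n a)) ∩
            frontier (numericalRange (principalSubmatrix (kmsMatrix n a) j)) = {(b : ℂ)}) ∧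
        (¬ (Odd n ∧ (j : ℕ) + 1 = (n + 1) / 2 ∧ 1 < ‖a‖) →
          frontier (numericalRange (kmsMatrix n a)) ∩
            frontier (numericalRange (principalSubmatrix (kmsMatrix n a) j)) = ∅) ∧
        ((b : ℂ) ∈ frontier (numericalRange (kmsMatrix n a)) ∩
            frontier (numericalRange (principalSubmatrix (kmsMatrix n a) j)) →
          ∃ x : EuclideanSpace ℂ (Fin n),
            ‖x‖ = 1 ∧
            x j = 0 ∧
            (∀ (k : ℕ) (p q : Fin n), (p : ℕ) + k = j → (q : ℕ) = j + k →
              x q = -(starRingEnd ℂ a / (‖a‖ : ℂ)) ^ (2 * k) * x p) ∧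
            (a.im = 0 → ∀ (k : ℕ) (p q : Fin n), (p : ℕ) + k = j → (q : ℕ) = j + k →
              x q = -x p) ∧
            Matrix.toEuclideanLin (ℜ (kmsMatrix n a) : Matrix (Fin n) (Fin n) ℂ) x
              = (b : ℂ) • x ∧
            inner ℂ x (Matrix.toEuclideanLin (kmsMatrix n a) x) = (b : ℂ)) := by
  have ha : a ≠ 0 := norm_ne_zero_iff.1 ha0
  have hr : 0 < ‖a‖ := norm_pos_iff.2 ha
  have hd : ∀ i, starRingEnd ℂ (kmsPhase n a i) * kmsPhase n a i = 1 := conj_kmsPhase_mul_self ha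
  obtain ⟨μ, hP, y, hy0, hy⟩ := exists_posSemidef_and_mem_ker (by omega : 0 < n) ‖a‖
  have hcenter : ∀ j : Fin n, Odd n ∧ (j : ℕ) + 1 = (n + 1) / 2 ∧ 1 < ‖a‖ ↔
      n = 2 * j + 1 ∧ 1 < ‖a‖ := fun j => by
    rw [← and_assoc, Nat.odd_iff]
    refine and_congr_left fun _ => ?_
    omega
  have hinter : ∀ j : Fin n, frontier (numericalRange (kmsMatrix n a)) ∩
      frontier (numericalRange (principalSubmatrix (kmsMatrix n a) j)) =
      frontier (numericalRange (kmsMatrix n (‖a‖ : ℂ))) ∩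
        numericalRange (principalSubmatrix (kmsMatrix n (‖a‖ : ℂ)) j) := fun j => by
    rw [frontier_inter_frontier_principalSubmatrix,
      numericalRange_eq_of_similar hd (kmsMatrix_apply_eq ha),
      numericalRange_eq_of_similar (A := principalSubmatrix (kmsMatrix n a) j)
        (B := principalSubmatrix (kmsMatrix n (‖a‖ : ℂ)) j) (d := fun i => kmsPhase n a i)
        (fun i => hd i) fun i k => kmsMatrix_apply_eq ha _ _]
  -- pulling a vector back along the diagonal unitary matrix
  have hpull : ∀ x : Fin n → ℂ,
      kmsPhase n a * (fun i => starRingEnd ℂ (kmsPhase n a i) * x i) = x := fun x => by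
      ext i
      simp only [Pi.mul_apply]
      linear_combination x i * hd i
  have heig : ∀ x : Fin n → ℂ, kmsPencil n ‖a‖ (-1) μ *ᵥ x = 0 →
      (ℜ (kmsMatrix n a) : Matrix (Fin n) (Fin n) ℂ) *ᵥ
        (fun i => starRingEnd ℂ (kmsPhase n a i) * x i) =
          ((-μ / 2 : ℝ) : ℂ) • fun i => starRingEnd ℂ (kmsPhase n a i) * x i := fun x hx => by
    rw [realPart_kmsMatrix_mulVec_eq_smul_iff ha, hpull]
    intro i
    have := congrFun hx i
    rw [kmsPencil_mulVec] at this
    simp only [map_neg, map_one, Pi.zero_apply] at this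
    push_cast
    linear_combination this
  refine ⟨-μ / 2, mem_spectrum_matrix_iff.2 ⟨_, fun h => hy0 ?_, heig y hy⟩,
    fun z hz => im_eq_zero_and_le_re_of_mem_spectrum ha hP hz, fun j => ⟨fun h => ?_, fun h => ?_,
      fun h => ?_⟩⟩
  · rw [← hpull y, h, mul_zero]
  · obtain ⟨hjn, hr1⟩ := (hcenter j).1 h
    rw [hinter]
    refine Set.eq_singleton_iff_unique_mem.2 ⟨mem_frontier_inter hn hr1 hP hy0 hy hjn, ?_⟩
    rintro z ⟨hz, hzj⟩
    exact (exists_of_mem_frontier_inter hr ha1 hP hy0 hy hz hzj).2.2.1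
  · rw [hinter, Set.eq_empty_iff_forall_notMem]
    rintro z ⟨hz, hzj⟩
    obtain ⟨hr1, hjn, -⟩ := exists_of_mem_frontier_inter hr ha1 hP hy0 hy hz hzj
    exact h ((hcenter j).2 ⟨hjn, hr1⟩)
  · rw [hinter] at h
    obtain ⟨-, hjn, -, x, hx, hxj, hanti, hker, hform⟩ :=
      exists_of_mem_frontier_inter hr ha1 hP hy0 hy h.1 h.2
    have hsym : ∀ (k : ℕ) (p q : Fin n), (p : ℕ) + k = j → (q : ℕ) = j + k →
        starRingEnd ℂ (kmsPhase n a q) * x q =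
          -(starRingEnd ℂ a / (‖a‖ : ℂ)) ^ (2 * k) * (starRingEnd ℂ (kmsPhase n a p) * x p) := by
      intro k p q hp hq
      have hqp : q = p.rev := Fin.ext (by rw [Fin.val_rev]; omega)
      have hq' : (q : ℕ) = p + 2 * k := by omega
      have hxq : x q = -x p := by rw [hqp, hanti]
      simp only [kmsPhase, map_pow, map_div₀, Complex.conj_ofReal, hxq, hq', pow_add, map_mul]
      ring
    let w : EuclideanSpace ℂ (Fin n) :=
      WithLp.toLp 2 fun i => starRingEnd ℂ (kmsPhase n a i) * x i
    refine ⟨w, ?_, ?_, hsym, fun him k p q hp hq => ?_, ?_, ?_⟩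
    · rw [norm_eq_one_iff_dotProduct, ← star_mul_dotProduct_mul hd, ← hx]
      simp only [w, hpull]
    · simp [w, hxj]
    · -- for real `a` the phase `a / |a|` is `±1`
      have h1 : (starRingEnd ℂ a / (‖a‖ : ℂ)) ^ 2 = 1 := by
        have h2 := conj_div_norm_mul_self ha
        have h3 : starRingEnd ℂ a = a := Complex.conj_eq_iff_im.2 him
        rw [map_div₀, Complex.conj_ofReal, h3] at h2
        rw [h3, sq, h2]
      have h2 := hsym k p q hp hq
      rw [pow_mul, h1, one_pow, neg_one_mul] at h2
      exact h2
    · rw [Matrix.toLpLin_apply]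
      simp only [w, heig x hker]
      rfl
    · rw [inner_toEuclideanLin_eq_dotProduct,
        star_dotProduct_mulVec_of_similar (kmsMatrix_apply_eq ha), hform]
      have : kmsPhase n a * w.ofLp = x := hpull x
      rw [this]
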